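/- Let $(G,d)$ be a complete, doubling metric group (a topological group whose topology is given by $d$) whose left translations $\tau_q(x)=q\cdot x$ are isometries and which carries dilations: continuous group homomorphisms $\delta_r:G\to G$, $r>0$, with $\delta_1=\mathrm{id}$, $d(\delta_r(x),\delta_r(y))=r\,d(x,y)$ and $\delta_{rs}=\delta_r\circ\delta_s$. (Doubling: there is $M\in\mathbb N$ such that every closed ball of radius $r>0$ is covered by $M$ closed balls of radius $r/2$.) Let $N\ge 2$, $E=\{1,\dots,N\}$, and let $S_i=\tau_{q_i}\circ\delta_{r_i}$ with $q_i\in G$, $r_i\in(0,1)$, $i\in E$. Assume the open set condition: there is a non-empty open set $O\subset G$ with $S_i(O)\subset O$ for all $i$ and $S_i(O)\cap S_j(O)=\emptyset$ for $i\neq j$. Let $C$ be the self-similar set of $(S_i)$, i.e. the unique non-empty compact set with $C=\bigcup_{i\in E} S_i(C)$, let $s$ be its dimension, given by $\sum_{i\in E} r_i^s=1$, and let $\mu=\mathcal H^s(C)^{-1}\,\mathcal H^s\lfloor C$, where $\mathcal H^s$ is the $s$-dimensional Hausdorff measure of $d$. For a finite word $w=w_1\dots w_n$ over $E$ put $S_w=S_{w_1}\circ\dots\circ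 S_{w_n}$ and $C_w=S_w(C)$ (with $S_w=\mathrm{id}$ for the empty word). For $v=(v_n)_{n\ge1}\in E^{\mathbb N}$ let $v|_n=v_1\dots v_n$ and let $\pi(v)$ be the point with $\{\pi(v)\}=\bigcap_{n\ge 1}C_{v|_n}$. Let $\tilde\mu$ be the product measure $\bigotimes_{\mathbb N}\big(\sum_{i\in E}r_i^s\,\epsilon_i\big)$ on $E^{\mathbb N}$, $\epsilon_i$ being the Dirac measure at $i$. Let $k(x,y)=\Omega(x^{-1}\cdot y)/d(x,y)^s$, $x\ne y$, be an $s$-homogeneous kernel; that is, $\Omega:G\setminus\{e\}\to\mathbb R$ is continuous, not identically zero, and $\Omega(\delta_r(x))=\Omega(x)$ for all $x$ and $r>0$, where $e$ is the identity of $G$. For $f\in L^1(\mu)$ the symbolic maximal singular operator is $$T^*_{\mathrm{sy}}(f)(v)=\sup_{1\le m<n}\left|\int^{*}_{C_{v|_m}\setminus C_{v|_n}}k(\pi(v),y)f(y)\,d\mu(y)\right|\in[0,\infty],\qquad v\in E^{\mathbb N},$$ where $\int^{*}g\,d\mu$ is $\int g\,d\mu$ if $g$ is $\mu$-integrable and $0$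 otherwise. Suppose that there are a finite word $w$ and a point $x_w\in C$ with $S_w(x_w)=x_w$ such that $$\int_{C\setminus C_w}k(x_w,y)\,d\mu(y)\neq 0,$$ meaning that the integral exists as a Lebesgue integral with a value in $[-\infty,\infty]$ and that this value is not $0$. Then $T^*_{\mathrm{sy}}(1)(v)=\infty$ for $\tilde\mu$-almost every $v\in E^{\mathbb N}$. -/

import Mathlib

open MeasureTheory Set
open scoped ENNReal

namespace MetricGroupIFS

noncomputable section

/-- A one-parameter family of dilations `δ_r`, `r > 0`, of a metric group: continuous group
homomorphisms with `δ_1 = id`, `d (δ_r x) (δ_r y) = r d x y` and `δ_{rs} = δ_r ∘ δ_s`.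
The value of `dil r` for `r ≤ 0` is irrelevant. -/
structure GroupDilations (G : Type*) [Group G] [MetricSpace G] where
  dil : ℝ → G → G
  continuous_dil : ∀ r : ℝ, 0 < r → Continuous (dil r)
  dil_mul_elem : ∀ r : ℝ, 0 < r → ∀ x y : G, dil r (x * y) = dil r x * dil r y
  dil_one : ∀ x : G, dil 1 x = x
  dist_dil : ∀ r : ℝ, 0 < r → ∀ x y : G, dist (dil r x) (dil r y) = r * dist x y
  dil_dil : ∀ r s : ℝ, 0 < r → 0 < s → ∀ x : G, dil (r * s) x = dil r (dil s x)

/-- The doubling property: there is a number `M` such that each closed ball is covered by `M`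
closed balls of half the radius. -/
def IsDoublingSpace (X : Type*) [MetricSpace X] : Prop :=
  ∃ M : ℕ, ∀ (x : X) (r : ℝ), 0 < r → ∃ c : Fin M → X,
    Metric.closedBall x r ⊆ ⋃ i, Metric.closedBall (c i) (r / 2)

/-- The similarities `S_i = τ_{q_i} ∘ δ_{r_i}`, that is `S_i x = q_i · δ_{r_i} x`. -/
def simil {G : Type*} [Group G] [MetricSpace G] (D : GroupDilations G) {N : ℕ}
    (q : Fin N → G) (r : Fin N → ℝ) (i : Fin N) (x : G) : G :=
  q i * D.dil (r i) x

/-- The open set condition. -/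
def OpenSetCondition {X : Type*} [MetricSpace X] {N : ℕ} (S : Fin N → X → X) : Prop :=
  ∃ O : Set X, IsOpen O ∧ O.Nonempty ∧ (∀ i, S i '' O ⊆ O) ∧
    ∀ i j, i ≠ j → Disjoint (S i '' O) (S j '' O)

/-- `C` is the self-similar set (limit set) of the iterated function system `S`. -/
def IsLimitSet {X : Type*} [MetricSpace X] {N : ℕ} (S : Fin N → X → X) (C : Set X) : Prop :=
  C.Nonempty ∧ IsCompact C ∧ C = ⋃ i, S i '' C

/-- `S_w = S_{w_1} ∘ ⋯ ∘ S_{w_n}` for a finite word `w`. -/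
def wordMap {X : Type*} {N : ℕ} (S : Fin N → X → X) : List (Fin N) → X → X
  | [] => id
  | i :: w => S i ∘ wordMap S w

/-- `C_w = S_w (C)`. -/
def piece {X : Type*} {N : ℕ} (S : Fin N → X → X) (C : Set X) (w : List (Fin N)) : Set X :=
  wordMap S w '' C

/-- The word `v|_n` of the first `n` letters of `v`; here `v 0` is the first letter. -/
def initialWord {N : ℕ} (v : ℕ → Fin N) (n : ℕ) : List (Fin N) :=
  List.ofFn fun i : Fin n => v i

open Classical in
/-- The coding map `π`: the only point of `⋂ n, C_{v|_n}` (see `singleton_codingMap`). -/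
def codingMap {X : Type*} [Nonempty X] {N : ℕ} (S : Fin N → X → X) (C : Set X)
    (v : ℕ → Fin N) : X :=
  Classical.epsilon fun x => x ∈ ⋂ n, piece S C (initialWord v n)

/-- The normalized Hausdorff measure `μ = H^s(C)⁻¹ H^s ⌞ C`. -/
def limitMeasure {X : Type*} [MetricSpace X] [MeasurableSpace X] [BorelSpace X]
    (s : ℝ) (C : Set X) : Measure X :=
  (Measure.hausdorffMeasure s C)⁻¹ • (Measure.hausdorffMeasure s).restrict C

/-- The product measure `μ̃ = ⨂_ℕ (∑ i, r_i ^ s ε_i)` on the sequence space. -/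
def codeMeasure {N : ℕ} (r : Fin N → ℝ) (s : ℝ) : Measure (ℕ → Fin N) :=
  Measure.infinitePi fun _ : ℕ => ∑ i, ENNReal.ofReal (r i ^ s) • Measure.dirac i

/-- The functions `Ω` entering the definition of the homogeneous kernels: continuous and not
identically zero off the identity, and homogeneous of degree zero. The value of `Ω` at the
identity plays no role. -/
def IsZeroHomogeneous {G : Type*} [Group G] [MetricSpace G] (D : GroupDilations G)
    (Ω : G → ℝ) : Prop :=
  ContinuousOn Ω {1}ᶜ ∧ (∃ x, x ≠ 1 ∧ Ω x ≠ 0) ∧ ∀ x r, 0 < r → Ω (D.dil r x) = Ω x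

/-- The kernel `k(x,y) = Ω(x⁻¹ · y) / d(x,y)^s`, `x ≠ y`. -/
def homKernel {G : Type*} [Group G] [MetricSpace G] (Ω : G → ℝ) (s : ℝ) (x y : G) : ℝ :=
  Ω (x⁻¹ * y) / dist x y ^ s

/-- `∫_A g dμ`, understood as an extended Lebesgue integral, exists in `[-∞, ∞]` and is not zero:
the integrals of the positive and of the negative part are different (in particular they are not
both infinite). -/
def HasNonzeroIntegralOn {X : Type*} [MeasurableSpace X] (μ : Measure X) (A : Set X)
    (g : X → ℝ) : Prop :=
  ∫⁻ y in A, ENNReal.ofReal (g y) ∂μ ≠ ∫⁻ y in A, ENNReal.ofReal (-g y) ∂μ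

/-- The symbolic maximal singular operator
`T*_sy(f)(v) = sup_{m < n} |∫*_{C_{v|_m} ∖ C_{v|_n}} k(π v, y) f(y) dμ(y)|`, where `m, n` range over
the positive integers. The integral `∫*` is by convention `0` when the integrand is not
integrable, as is the Bochner integral. -/
def symbolicMaximal {X : Type*} [MetricSpace X] [MeasurableSpace X] [Nonempty X]
    {N : ℕ} (S : Fin N → X → X) (C : Set X) (μ : Measure X) (k : X → X → ℝ)
    (f : X → ℝ) (v : ℕ → Fin N) : ℝ≥0∞ :=
  ⨆ (m : ℕ) (n : ℕ) (_ : 1 ≤ m) (_ : m < n),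
    ENNReal.ofReal |∫ y in piece S C (initialWord v m) \ piece S C (initialWord v n),
      k (codingMap S C v) y * f y ∂μ|

/-! Checks of the definitions. -/

theorem isProbabilityMeasure_codeMeasure {N : ℕ} {r : Fin N → ℝ} {s : ℝ}
    (hr : ∀ i, 0 < r i) (hs : ∑ i, r i ^ s = 1) : IsProbabilityMeasure (codeMeasure r s) := by
  have h : IsProbabilityMeasure
      (∑ i, ENNReal.ofReal (r i ^ s) • (Measure.dirac i : Measure (Fin N))) := by
    refine ⟨?_⟩
    simp only [Measure.coe_finsetSum, Finset.sum_apply, Measure.smul_apply, measure_univ,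
      smul_eq_mul, mul_one]
    rw [← ENNReal.ofReal_sum_of_nonneg fun i _ => (Real.rpow_pos_of_pos (hr i) s).le, hs,
      ENNReal.ofReal_one]
  unfold codeMeasure
  infer_instance

theorem wordMap_append {X : Type*} {N : ℕ} (S : Fin N → X → X) (u w : List (Fin N)) :
    wordMap S (u ++ w) = wordMap S u ∘ wordMap S w := by
  induction u with
  | nil => rfl
  | cons i u ih => simp [wordMap, ih, Function.comp_assoc]

theorem initialWord_succ {N : ℕ} (v : ℕ → Fin N) (n : ℕ) :
    initialWord v (n + 1) = initialWord v n ++ [v n] := by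
  rw [initialWord, List.ofFn_succ_last]
  simp [initialWord]

theorem dist_wordMap {X : Type*} [MetricSpace X] {N : ℕ} {S : Fin N → X → X} {ρ : ℝ}
    (hρ : 0 ≤ ρ) (hS : ∀ i x y, dist (S i x) (S i y) ≤ ρ * dist x y) (w : List (Fin N)) (x y : X) :
    dist (wordMap S w x) (wordMap S w y) ≤ ρ ^ w.length * dist x y := by
  induction w with
  | nil => simp [wordMap]
  | cons i w ih =>
    calc dist (S i (wordMap S w x)) (S i (wordMap S w y))
        ≤ ρ * dist (wordMap S w x) (wordMap S w y) := hS _ _ _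
      _ ≤ ρ * (ρ ^ w.length * dist x y) := by gcongr
      _ = ρ ^ (i :: w).length * dist x y := by simp [pow_succ]; ring

theorem singleton_codingMap {X : Type*} [MetricSpace X] [Nonempty X] {N : ℕ} {S : Fin N → X → X}
    {C : Set X} {r : Fin N → ℝ} (hr : ∀ i, 0 < r i ∧ r i < 1)
    (hS : ∀ i x y, dist (S i x) (S i y) = r i * dist x y) (hC : IsLimitSet S C)
    (v : ℕ → Fin N) : {codingMap S C v} = ⋂ n, piece S C (initialWord v n) := by
  obtain ⟨hne, hcp, heq⟩ := hC
  obtain ⟨ρ, hρ0, hρ1, hρ⟩ : ∃ ρ : ℝ, 0 ≤ ρ ∧ ρ < 1 ∧ ∀ i, r i ≤ ρ := by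
    have : (Finset.univ : Finset (Fin N)).Nonempty := ⟨v 0, Finset.mem_univ _⟩
    obtain ⟨j, -, hj⟩ := Finset.exists_max_image Finset.univ r this
    exact ⟨r j, (hr j).1.le, (hr j).2, fun i => hj i (Finset.mem_univ _)⟩
  have hS' : ∀ i x y, dist (S i x) (S i y) ≤ ρ * dist x y := fun i x y => by
    rw [hS]; exact mul_le_mul_of_nonneg_right (hρ i) dist_nonneg
  have hcont : ∀ w, Continuous (wordMap S w) := fun w =>
    (LipschitzWith.of_dist_le_mul (K := ⟨ρ ^ w.length, pow_nonneg hρ0 _⟩)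
      fun x y => dist_wordMap hρ0 hS' w x y).continuous
  have hcomp : ∀ w, IsCompact (piece S C w) := fun w => hcp.image (hcont w)
  have hex : (⋂ n, piece S C (initialWord v n)).Nonempty := by
    refine IsCompact.nonempty_iInter_of_sequence_nonempty_isCompact_isClosed _ (fun n => ?_)
      (fun n => hne.image _) (hcomp _) (fun n => (hcomp _).isClosed)
    rintro _ ⟨x, hx, rfl⟩
    rw [initialWord_succ, wordMap_append]
    refine ⟨S (v n) x, ?_, by simp [wordMap]⟩
    rw [heq]
    exact mem_iUnion.2 ⟨v n, mem_image_of_mem _ hx⟩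
  have hmem : codingMap S C v ∈ ⋂ n, piece S C (initialWord v n) :=
    Classical.epsilon_spec hex
  refine Subset.antisymm (singleton_subset_iff.2 hmem) fun z hz => ?_
  have hle : ∀ n : ℕ, dist z (codingMap S C v) ≤ ρ ^ n * Metric.diam C := by
    intro n
    obtain ⟨a, ha, ha'⟩ := mem_iInter.1 hz n
    obtain ⟨b, hb, hb'⟩ := mem_iInter.1 hmem n
    rw [← ha', ← hb']
    refine (dist_wordMap hρ0 hS' _ a b).trans ?_
    have : (initialWord v n).length = n := by simp [initialWord]
    rw [this]
    exact mul_le_mul_of_nonneg_left (Metric.dist_le_diam_of_mem hcp.isBounded ha hb)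
      (pow_nonneg hρ0 _)
  have hlim : Filter.Tendsto (fun n : ℕ => ρ ^ n * Metric.diam C) Filter.atTop (nhds 0) := by
    simpa using (tendsto_pow_atTop_nhds_zero_of_lt_one hρ0 hρ1).mul_const (Metric.diam C)
  exact dist_le_zero.1 (ge_of_tendsto' hlim hle)

end

end MetricGroupIFS

open MetricGroupIFS

/-! Write η for the given nonzero integral at the fixed point x of S_w. Under S_w the measure scales
by r_w^s and the kernel by r_w^(-s), so truncated integrals are invariant: integrating over C_p ∖
C_{pu} at S_p(z) is the same as integrating over C ∖ C_u at z (`setIntegral_homKernel_piece_diff`).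
As S_w fixes x, telescoping along w, ww, www, … gives exactly Mη over C ∖ C_{w^M}
(`setIntegral_homKernel_diff_wordPow`).

The value Mη persists for base points z ∈ C near x, because x has positive distance from C ∖ C_{w^M}
and the kernel is continuous off the diagonal (`continuousWithinAt_integral_homKernel`). The
positive distance is where doubling and the open set condition enter: x lies in no other piece of
the level of w (`notMem_piece_of_fixed`).

Almost every v contains w^K after some prefix p = v|_m (`ae_exists_initialWord_append`). Then π(v) =
S_p(z) with z ∈ C_{w^K}, which is close to x for large K, so one truncation at π(v) has modulus at
least M|η| - 1. Here M is arbitrary. -/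

namespace MetricGroupIFS

/-! ### Words and similarities -/

/-- The contraction ratio `r_w = r_{w_1} ⋯ r_{w_n}` of a word. -/
def wordRatio {N : ℕ} (r : Fin N → ℝ) (w : List (Fin N)) : ℝ := (w.map r).prod

theorem wordRatio_append {N : ℕ} (r : Fin N → ℝ) (u w : List (Fin N)) :
    wordRatio r (u ++ w) = wordRatio r u * wordRatio r w := by
  simp [wordRatio]

theorem wordRatio_pos {N : ℕ} {r : Fin N → ℝ} (hr : ∀ i, 0 < r i) (w : List (Fin N)) :
    0 < wordRatio r w := by
  refine List.prod_pos fun a ha => ?_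
  obtain ⟨i, -, rfl⟩ := List.mem_map.1 ha
  exact hr i

theorem wordRatio_lt_one {N : ℕ} {r : Fin N → ℝ} (hr : ∀ i, 0 < r i ∧ r i < 1)
    {w : List (Fin N)} (hw : w ≠ []) : wordRatio r w < 1 := by
  have hle : ∀ w : List (Fin N), wordRatio r w ≤ 1 := by
    intro w
    induction w with
    | nil => simp [wordRatio]
    | cons i w ih =>
      have : wordRatio r (i :: w) = r i * wordRatio r w := by simp [wordRatio]
      rw [this]
      exact mul_le_one₀ (hr i).2.le (wordRatio_pos (fun i => (hr i).1) w).le ih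
  cases w with
  | nil => exact absurd rfl hw
  | cons i w =>
    have : wordRatio r (i :: w) = r i * wordRatio r w := by simp [wordRatio]
    rw [this]
    exact mul_lt_one_of_nonneg_of_lt_one_left (hr i).1.le (hr i).2 (hle w)

/-- The concatenation of `n` copies of `w`. -/
def wordPow {N : ℕ} (w : List (Fin N)) (n : ℕ) : List (Fin N) := (List.replicate n w).flatten

theorem wordPow_succ {N : ℕ} (w : List (Fin N)) (n : ℕ) :
    wordPow w (n + 1) = w ++ wordPow w n := by
  simp [wordPow, List.replicate_succ]

theorem wordPow_add {N : ℕ} (w : List (Fin N)) (m n : ℕ) :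
    wordPow w (m + n) = wordPow w m ++ wordPow w n := by
  simp only [wordPow, List.replicate_add, List.flatten_append]

theorem wordPow_succ' {N : ℕ} (w : List (Fin N)) (n : ℕ) :
    wordPow w (n + 1) = wordPow w n ++ w := by
  rw [wordPow_add]; simp [wordPow]

theorem wordRatio_wordPow {N : ℕ} (r : Fin N → ℝ) (w : List (Fin N)) (n : ℕ) :
    wordRatio r (wordPow w n) = wordRatio r w ^ n := by
  induction n with
  | zero => simp [wordPow, wordRatio]
  | succ n ih => rw [wordPow_succ, wordRatio_append, ih, pow_succ']

theorem wordMap_wordPow_fixed {X : Type*} {N : ℕ} {S : Fin N → X → X} {w : List (Fin N)} {x : X}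
    (hx : wordMap S w x = x) (n : ℕ) : wordMap S (wordPow w n) x = x := by
  induction n with
  | zero => rfl
  | succ n ih => rw [wordPow_succ, wordMap_append, Function.comp_apply, ih, hx]

theorem dist_wordMap_eq {X : Type*} [MetricSpace X] {N : ℕ} {S : Fin N → X → X} {r : Fin N → ℝ}
    (hS : ∀ i x y, dist (S i x) (S i y) = r i * dist x y) (w : List (Fin N)) (x y : X) :
    dist (wordMap S w x) (wordMap S w y) = wordRatio r w * dist x y := by
  induction w with
  | nil => simp [wordMap, wordRatio]
  | cons i w ih =>
    have : wordRatio r (i :: w) = r i * wordRatio r w := by simp [wordRatio]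
    rw [this, wordMap, Function.comp_apply, Function.comp_apply, hS, ih, mul_assoc]

theorem wordMap_injective {X : Type*} [MetricSpace X] {N : ℕ} {S : Fin N → X → X} {r : Fin N → ℝ}
    (hr : ∀ i, 0 < r i) (hS : ∀ i x y, dist (S i x) (S i y) = r i * dist x y)
    (w : List (Fin N)) : Function.Injective (wordMap S w) := by
  intro x y h
  have h1 := dist_wordMap_eq hS w x y
  rw [h, dist_self, eq_comm, mul_eq_zero] at h1
  exact dist_eq_zero.1 (h1.resolve_left (wordRatio_pos hr w).ne')

theorem continuous_wordMap {X : Type*} [MetricSpace X] {N : ℕ} {S : Fin N → X → X} {r : Fin N → ℝ}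
    (hr : ∀ i, 0 < r i) (hS : ∀ i x y, dist (S i x) (S i y) = r i * dist x y)
    (w : List (Fin N)) : Continuous (wordMap S w) :=
  (LipschitzWith.of_dist_le_mul (K := ⟨wordRatio r w, (wordRatio_pos hr w).le⟩)
    fun x y => (dist_wordMap_eq hS w x y).le).continuous

theorem wordMap_surjective {X : Type*} {N : ℕ} {S : Fin N → X → X}
    (hsurj : ∀ i, Function.Surjective (S i)) (w : List (Fin N)) :
    Function.Surjective (wordMap S w) := by
  induction w with
  | nil => exact Function.surjective_id
  | cons i w ih => exact (hsurj i).comp ih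

theorem image_wordMap_subset {X : Type*} {N : ℕ} {S : Fin N → X → X} {A : Set X}
    (hA : ∀ i, S i '' A ⊆ A) (w : List (Fin N)) : wordMap S w '' A ⊆ A := by
  induction w with
  | nil => simp [wordMap]
  | cons i w ih =>
    rw [wordMap, image_comp]
    exact (image_mono ih).trans (hA i)

theorem IsLimitSet.image_subset {X : Type*} [MetricSpace X] {N : ℕ} {S : Fin N → X → X}
    {C : Set X} (hC : IsLimitSet S C) (i : Fin N) : S i '' C ⊆ C := by
  conv_rhs => rw [hC.2.2]
  exact subset_iUnion (fun i => S i '' C) i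

theorem piece_append {X : Type*} {N : ℕ} (S : Fin N → X → X) (C : Set X) (u w : List (Fin N)) :
    piece S C (u ++ w) = wordMap S u '' piece S C w := by
  rw [piece, piece, wordMap_append, image_comp]

theorem IsLimitSet.piece_subset {X : Type*} [MetricSpace X] {N : ℕ} {S : Fin N → X → X}
    {C : Set X} (hC : IsLimitSet S C) (w : List (Fin N)) : piece S C w ⊆ C :=
  image_wordMap_subset hC.image_subset w

theorem IsLimitSet.piece_append_subset {X : Type*} [MetricSpace X] {N : ℕ} {S : Fin N → X → X}
    {C : Set X} (hC : IsLimitSet S C) (u w : List (Fin N)) : piece S C (u ++ w) ⊆ piece S C u := by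
  rw [piece_append]
  exact image_mono (hC.piece_subset w)

/-- A limit set is covered by its pieces of a given level. -/
theorem IsLimitSet.exists_mem_piece_length {X : Type*} [MetricSpace X] {N : ℕ}
    {S : Fin N → X → X} {C : Set X} (hC : IsLimitSet S C) (n : ℕ) {c : X} (hc : c ∈ C) :
    ∃ u : List (Fin N), u.length = n ∧ c ∈ piece S C u := by
  induction n generalizing c with
  | zero => exact ⟨[], rfl, c, hc, rfl⟩
  | succ n ih =>
    rw [hC.2.2] at hc
    obtain ⟨i, c', hc', rfl⟩ := mem_iUnion.1 hc
    obtain ⟨u, hu, a, ha, rfl⟩ := ih hc'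
    exact ⟨i :: u, by simp [hu], a, ha, rfl⟩

/-- Each point of a limit set lies in a piece of contraction ratio comparable to a given scale. -/
theorem IsLimitSet.exists_mem_piece_ratio {X : Type*} [MetricSpace X] {N : ℕ}
    {S : Fin N → X → X} {C : Set X} (hC : IsLimitSet S C) {r : Fin N → ℝ}
    (hr : ∀ i, 0 < r i ∧ r i < 1) {ρ : ℝ} (hρ0 : 0 < ρ) (hρ : ∀ i, ρ ≤ r i) {c : X} (hc : c ∈ C)
    {l : ℝ} (hl0 : 0 < l) (hl1 : l ≤ 1) :
    ∃ t : List (Fin N), c ∈ piece S C t ∧ ρ * l ≤ wordRatio r t ∧ wordRatio r t ≤ l := by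
  obtain ⟨R, hR0, hR1, hR⟩ : ∃ R : ℝ, 0 < R ∧ R < 1 ∧ ∀ i, r i ≤ R := by
    rcases isEmpty_or_nonempty (Fin N) with h | h
    · exact ⟨1 / 2, by norm_num, by norm_num, fun i => h.elim i⟩
    · obtain ⟨j, hj⟩ := Finite.exists_max r
      exact ⟨r j, (hr j).1, (hr j).2, hj⟩
  -- Peel off letters, dividing the scale by each ratio, and stop once the scale is at least 1. The
  -- last division may overshoot 1, hence the weaker bound `ρ * l ≤ 1` in the induction.
  have key : ∀ n : ℕ, ∀ c ∈ C, ∀ l : ℝ, R ^ n ≤ l → ρ * l ≤ 1 →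
      ∃ t : List (Fin N), c ∈ piece S C t ∧ ρ * l ≤ wordRatio r t ∧ wordRatio r t ≤ l := by
    intro n
    induction n with
    | zero =>
      intro c hc l h1 h2
      exact ⟨[], ⟨c, hc, rfl⟩, by simpa [wordRatio] using h2, by simpa [wordRatio] using h1⟩
    | succ n ih =>
      intro c hc l h1 h2
      rcases le_or_gt 1 l with h | h
      · exact ⟨[], ⟨c, hc, rfl⟩, by simpa [wordRatio] using h2, by simpa [wordRatio] using h⟩
      rw [hC.2.2] at hc
      obtain ⟨i, c', hc', rfl⟩ := mem_iUnion.1 hc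
      have hl : 0 < l := (pow_pos hR0 _).trans_le h1
      have hi := (hr i).1
      obtain ⟨t, ⟨a, ha, rfl⟩, ht1, ht2⟩ := ih c' hc' (l / r i)
        (by
          rw [le_div_iff₀ hi]
          calc R ^ n * r i ≤ R ^ n * R := by gcongr; exact hR i
            _ ≤ l := by rwa [← pow_succ])
        (by
          rw [← mul_div_assoc, div_le_one hi]
          nlinarith [hρ i])
      refine ⟨i :: t, ⟨a, ha, rfl⟩, ?_, ?_⟩
      · have : wordRatio r (i :: t) = r i * wordRatio r t := by simp [wordRatio]
        rw [this]
        rw [← mul_div_assoc, div_le_iff₀ hi] at ht1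
        linarith
      · have : wordRatio r (i :: t) = r i * wordRatio r t := by simp [wordRatio]
        rw [this]
        rw [le_div_iff₀ hi] at ht2
        linarith
  obtain ⟨n, hn⟩ := exists_pow_lt_of_lt_one hl0 hR1
  refine key n c hc l hn.le ?_
  obtain ⟨u, hu, -⟩ := hC.exists_mem_piece_length 1 hc
  obtain ⟨i, -⟩ := List.length_eq_one_iff.1 hu
  nlinarith [hρ i, (hr i).2]

/-! ### The open set condition in doubling spaces -/

/-- Injectivity removes the common prefix. At the first letter where `a` and `b` differ the open set
condition separates the images, and all later letters keep them inside `O`. -/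
theorem disjoint_image_wordMap {X : Type*} [MetricSpace X] {N : ℕ} {S : Fin N → X → X}
    {r : Fin N → ℝ} (hr : ∀ i, 0 < r i) (hS : ∀ i x y, dist (S i x) (S i y) = r i * dist x y)
    {O : Set X} (hO : ∀ i, S i '' O ⊆ O) (hdisj : ∀ i j, i ≠ j → Disjoint (S i '' O) (S j '' O))
    (p a b y z : List (Fin N)) (hab : a.length = b.length) (hne : a ≠ b) :
    Disjoint (wordMap S (p ++ a ++ y) '' O) (wordMap S (p ++ b ++ z) '' O) := by
  have hSi : ∀ i, Function.Injective (S i) := fun i => by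
    simpa [wordMap] using wordMap_injective hr hS [i]
  have key : Disjoint (wordMap S a '' O) (wordMap S b '' O) := by
    induction a generalizing b with
    | nil => exact absurd (List.length_eq_zero_iff.1 hab.symm).symm hne
    | cons i a ih =>
      cases b with
      | nil => simp at hab
      | cons j b =>
        by_cases hij : i = j
        · subst hij
          rw [wordMap, wordMap, image_comp, image_comp]
          exact (disjoint_image_iff (hSi i)).2
            (ih b (by simpa using hab) (by simpa using hne))
        · rw [wordMap, wordMap, image_comp, image_comp]
          exact (hdisj i j hij).mono (image_mono (image_wordMap_subset hO a))
            (image_mono (image_wordMap_subset hO b))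
  rw [List.append_assoc, List.append_assoc, wordMap_append S p, wordMap_append S p, image_comp,
    image_comp, disjoint_image_iff (wordMap_injective hr hS p), wordMap_append, wordMap_append,
    image_comp, image_comp]
  exact key.mono (image_mono (image_wordMap_subset hO y)) (image_mono (image_wordMap_subset hO z))

theorem IsDoublingSpace.exists_cover {X : Type*} [MetricSpace X] (h : IsDoublingSpace X) (n : ℕ) :
    ∃ K : ℕ, ∀ (x : X) (R : ℝ), 0 < R → ∃ c : Fin K → X,
      Metric.closedBall x R ⊆ ⋃ i, Metric.closedBall (c i) (R / 2 ^ n) := by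
  obtain ⟨M, hM⟩ := h
  induction n with
  | zero => exact ⟨1, fun x R _ => ⟨fun _ => x, by simp [subset_def]⟩⟩
  | succ n ih =>
    obtain ⟨K, hK⟩ := ih
    refine ⟨M * K, fun x R hR => ?_⟩
    obtain ⟨c, hc⟩ := hM x R hR
    choose d hd using fun i => hK (c i) (R / 2) (half_pos hR)
    refine ⟨fun m => d (finProdFinEquiv.symm m).1 (finProdFinEquiv.symm m).2, fun y hy => ?_⟩
    obtain ⟨i, hi⟩ := mem_iUnion.1 (hc hy)
    obtain ⟨j, hj⟩ := mem_iUnion.1 (hd i hi)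
    refine mem_iUnion.2 ⟨finProdFinEquiv (i, j), ?_⟩
    simpa [pow_succ', div_div] using hj

/-- In a doubling space, the number of points of a ball that are separated by a fixed proportion
of its radius is bounded. -/
theorem IsDoublingSpace.exists_separated_bound {X : Type*} [MetricSpace X]
    (h : IsDoublingSpace X) {R ε : ℝ} (hR : 0 < R) (hε : 0 < ε) :
    ∃ K : ℕ, ∀ (x : X) (l : ℝ), 0 < l → ∀ (n : ℕ) (a : Fin n → X),
      (∀ i, dist (a i) x ≤ l * R) → (∀ i j, i ≠ j → l * ε ≤ dist (a i) (a j)) → n ≤ K := by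
  -- After `m` halvings, a covering ball is too small to contain two separated points.
  obtain ⟨m, hm⟩ : ∃ m : ℕ, R / 2 ^ m < ε / 2 := by
    obtain ⟨m, hm⟩ := exists_pow_lt_of_lt_one (div_pos (half_pos hε) hR)
      (by norm_num : (1 / 2 : ℝ) < 1)
    refine ⟨m, ?_⟩
    rw [lt_div_iff₀ hR] at hm
    simpa [div_eq_mul_inv, mul_comm] using hm
  obtain ⟨K, hK⟩ := h.exists_cover m
  refine ⟨K, fun x l hl n a ha hsep => ?_⟩
  obtain ⟨c, hc⟩ := hK x (l * R) (mul_pos hl hR)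
  choose f hf using fun i => mem_iUnion.1 (hc (Metric.mem_closedBall.2 (ha i)))
  have hinj : Function.Injective f := by
    intro i j hij
    by_contra hne
    have h1 := Metric.mem_closedBall.1 (hf i)
    have h2 := Metric.mem_closedBall.1 (hf j)
    rw [hij] at h1
    have h3 := dist_triangle_right (a i) (a j) (c (f j))
    have h4 := hsep i j hne
    have h5 : l * R / 2 ^ m < l * (ε / 2) := by
      rw [mul_div_assoc]; exact mul_lt_mul_of_pos_left hm hl
    linarith
  simpa using Fintype.card_le_of_injective f hinj

/-- Under the open set condition in a doubling space, the fixed point of `S_w` lies in no other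
piece of the same level. -/
theorem notMem_piece_of_fixed {X : Type*} [MetricSpace X] {N : ℕ} {S : Fin N → X → X}
    {r : Fin N → ℝ} (hr : ∀ i, 0 < r i ∧ r i < 1)
    (hS : ∀ i x y, dist (S i x) (S i y) = r i * dist x y) (hsurj : ∀ i, Function.Surjective (S i))
    (hdoubling : IsDoublingSpace X) (hosc : OpenSetCondition S) {C : Set X}
    (hC : IsLimitSet S C) {w u : List (Fin N)} {x : X} (hx : wordMap S w x = x)
    (hlen : u.length = w.length) (hne : u ≠ w) : x ∉ piece S C u := by
  rintro ⟨c, hc, hcx⟩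
  obtain ⟨O, hOo, ⟨a, ha⟩, hO, hdisj⟩ := hosc
  have hr0 : ∀ i, 0 < r i := fun i => (hr i).1
  have hw : w ≠ [] := by
    rintro rfl
    exact hne (List.length_eq_zero_iff.1 hlen)
  obtain ⟨ρ, hρ0, hρ⟩ : ∃ ρ : ℝ, 0 < ρ ∧ ∀ i, ρ ≤ r i := by
    have : Nonempty (Fin N) := ⟨w.head hw⟩
    obtain ⟨j, hj⟩ := Finite.exists_min r
    exact ⟨r j, hr0 j, hj⟩
  obtain ⟨ε, hε0, hε⟩ := Metric.isOpen_iff.1 hOo a ha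
  obtain ⟨B, hB0, hB⟩ : ∃ B : ℝ, 0 < B ∧ ∀ y ∈ C, dist a y ≤ B := by
    obtain ⟨B, hB⟩ := hC.2.1.isBounded.subset_closedBall a
    exact ⟨max B 1, by positivity, fun y hy => by
      rw [dist_comm]; exact (Metric.mem_closedBall.1 (hB hy)).trans (le_max_left _ _)⟩
  set α := wordRatio r w with hα
  set β := wordRatio r u with hβ
  have hα0 : 0 < α := wordRatio_pos hr0 w
  have hα1 : α < 1 := wordRatio_lt_one hr hw
  have hβ0 : 0 < β := wordRatio_pos hr0 u
  -- If x = S_u(c), then x lies in C_{w^j u t} for every j, whenever c ∈ C_t. Choosing t = t_j of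
  -- ratio about α^(K-j) gives all these words, j = 0, …, K, a ratio comparable to α^K β. The images
  -- of `a` are then K + 1 points near x, separated at a comparable scale, one more than doubling
  -- allows.
  obtain ⟨K, hK⟩ := hdoubling.exists_separated_bound (R := β * B) (ε := β * ρ * ε)
    (by positivity) (by positivity)
  have hchoice : ∀ j : Fin (K + 1), ∃ t : List (Fin N), c ∈ piece S C t ∧
      ρ * α ^ (K - j : ℕ) ≤ wordRatio r t ∧ wordRatio r t ≤ α ^ (K - j : ℕ) := fun j =>
    hC.exists_mem_piece_ratio hr hρ0 hρ hc (pow_pos hα0 _) (pow_le_one₀ hα0.le hα1.le)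
  choose t htc ht1 ht2 using hchoice
  let p : Fin (K + 1) → List (Fin N) := fun j => wordPow w j ++ u ++ t j
  have hpr : ∀ j, wordRatio r (p j) = α ^ (j : ℕ) * β * wordRatio r (t j) := fun j => by
    simp only [p, wordRatio_append, wordRatio_wordPow, hα, hβ]
  have hpow : ∀ j : Fin (K + 1), α ^ (j : ℕ) * α ^ (K - j : ℕ) = α ^ K := fun j => by
    rw [← pow_add]; congr 1; omega
  have hp1 : ∀ j, α ^ K * (β * ρ) ≤ wordRatio r (p j) := fun j => by
    rw [hpr, ← hpow j]
    calc _ = α ^ (j : ℕ) * β * (ρ * α ^ (K - j : ℕ)) := by ring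
      _ ≤ _ := by gcongr; exact ht1 j
  have hp2 : ∀ j, wordRatio r (p j) ≤ α ^ K * β := fun j => by
    rw [hpr, ← hpow j]
    calc _ ≤ α ^ (j : ℕ) * β * α ^ (K - j : ℕ) := by gcongr; exact ht2 j
      _ = _ := by ring
  have hdis : ∀ i j, i < j → Disjoint (wordMap S (p i) '' O) (wordMap S (p j) '' O) := by
    intro i j hij
    -- After the common prefix w^i, the word `p i` continues with `u` and `p j` with `w`, two
    -- distinct words of equal length.
    have hj : p j = wordPow w i ++ w ++ (wordPow w (j - i - 1 : ℕ) ++ u ++ t j) := by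
      have : (j : ℕ) = i + 1 + (j - i - 1) := by
        have := Fin.lt_def.1 hij
        omega
      change wordPow w j ++ u ++ t j = _
      conv_lhs => rw [this, wordPow_add, wordPow_succ']
      simp only [List.append_assoc]
    rw [hj]
    exact disjoint_image_wordMap hr0 hS hO hdisj _ _ _ _ _ hlen hne
  have hsep : ∀ i j, i ≠ j →
      α ^ K * (β * ρ * ε) ≤ dist (wordMap S (p i) a) (wordMap S (p j) a) := by
    intro i j hij
    by_contra! hlt
    -- If the two points were too close, the preimage `b` would fall in the ε-ball around `a`, hence
    -- in `O`, and the two images of `O` would meet.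
    obtain ⟨b, hb⟩ := wordMap_surjective hsurj (p j) (wordMap S (p i) a)
    rw [← hb, dist_wordMap_eq hS] at hlt
    have hbO : b ∈ O := by
      apply hε
      rw [Metric.mem_ball]
      have h1 := mul_le_mul_of_nonneg_right (hp1 j) hε0.le
      exact lt_of_mul_lt_mul_left (by linarith : wordRatio r (p j) * dist b a <
        wordRatio r (p j) * ε) (wordRatio_pos hr0 _).le
    have hd : Disjoint (wordMap S (p i) '' O) (wordMap S (p j) '' O) := by
      rcases lt_or_gt_of_ne hij with h | h
      · exact hdis i j h
      · exact (hdis j i h).symm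
    exact disjoint_left.1 hd ⟨a, ha, rfl⟩ ⟨b, hbO, hb⟩
  have hnear : ∀ j, dist (wordMap S (p j) a) x ≤ α ^ K * (β * B) := by
    intro j
    obtain ⟨y, hy, hyc⟩ := htc j
    have hxy : wordMap S (p j) y = x := by
      simp only [p, wordMap_append, Function.comp_apply, hyc, hcx, wordMap_wordPow_fixed hx]
    rw [← hxy, dist_wordMap_eq hS, ← mul_assoc]
    exact mul_le_mul (hp2 j) (hB y hy) dist_nonneg (by positivity)
  have := hK x (α ^ K) (pow_pos hα0 _) (K + 1) (fun j => wordMap S (p j) a) hnear hsep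
  omega

/-- The other pieces of the level of `w` cover C ∖ C_w; they are finitely many compact sets and none
contains `x`. -/
theorem notMem_closure_diff_piece {X : Type*} [MetricSpace X] {N : ℕ} {S : Fin N → X → X}
    {r : Fin N → ℝ} (hr : ∀ i, 0 < r i ∧ r i < 1)
    (hS : ∀ i x y, dist (S i x) (S i y) = r i * dist x y) (hsurj : ∀ i, Function.Surjective (S i))
    (hdoubling : IsDoublingSpace X) (hosc : OpenSetCondition S) {C : Set X}
    (hC : IsLimitSet S C) {w : List (Fin N)} {x : X} (hx : wordMap S w x = x) :
    x ∉ closure (C \ piece S C w) := by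
  have hfin : {u : List (Fin N) | u.length = w.length ∧ u ≠ w}.Finite :=
    (List.finite_length_eq (Fin N) w.length).subset fun u hu => hu.1
  have hclosed : IsClosed (⋃ u ∈ {u : List (Fin N) | u.length = w.length ∧ u ≠ w}, piece S C u) :=
    hfin.isClosed_biUnion fun u _ =>
      (hC.2.1.image (continuous_wordMap (fun i => (hr i).1) hS u)).isClosed
  have hsub : C \ piece S C w ⊆
      ⋃ u ∈ {u : List (Fin N) | u.length = w.length ∧ u ≠ w}, piece S C u := by
    rintro c ⟨hc, hcw⟩
    obtain ⟨u, hu, hcu⟩ := hC.exists_mem_piece_length w.length hc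
    exact mem_biUnion (show _ ∧ _ from ⟨hu, fun h => hcw (h ▸ hcu)⟩) hcu
  intro hmem
  obtain ⟨u, hu, hxu⟩ := mem_iUnion₂.1 (closure_minimal hsub hclosed hmem)
  exact notMem_piece_of_fixed hr hS hsurj hdoubling hosc hC hx hu.1 hu.2 hxu

/-! ### Similarities of metric groups -/

theorem dist_simil {G : Type*} [Group G] [MetricSpace G]
    (hleft : ∀ g : G, Isometry fun x : G => g * x) (D : GroupDilations G) {N : ℕ} (q : Fin N → G)
    {r : Fin N → ℝ} (hr : ∀ i, 0 < r i) (i : Fin N) (x y : G) :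
    dist (simil D q r i x) (simil D q r i y) = r i * dist x y := by
  rw [simil, simil, (hleft (q i)).dist_eq, D.dist_dil _ (hr i)]

theorem simil_surjective {G : Type*} [Group G] [MetricSpace G] (D : GroupDilations G) {N : ℕ}
    (q : Fin N → G) {r : Fin N → ℝ} (hr : ∀ i, 0 < r i) (i : Fin N) :
    Function.Surjective (simil D q r i) := fun y => by
  refine ⟨D.dil (r i)⁻¹ ((q i)⁻¹ * y), ?_⟩
  rw [simil, ← D.dil_dil _ _ (hr i) (inv_pos.2 (hr i)), mul_inv_cancel₀ (hr i).ne', D.dil_one,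
    mul_inv_cancel_left]

/-- Translations cancel in x⁻¹y and dilations do not change Ω, so only the power of the distance
scales. -/
theorem homKernel_wordMap {G : Type*} [Group G] [MetricSpace G]
    (hleft : ∀ g : G, Isometry fun x : G => g * x) (D : GroupDilations G) {N : ℕ} (q : Fin N → G)
    {r : Fin N → ℝ} (hr : ∀ i, 0 < r i) {Ω : G → ℝ} (hΩ : IsZeroHomogeneous D Ω) (s : ℝ)
    (w : List (Fin N)) (x y : G) :
    homKernel Ω s (wordMap (simil D q r) w x) (wordMap (simil D q r) w y) =
      (wordRatio r w ^ s)⁻¹ * homKernel Ω s x y := by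
  have hang : ∀ w : List (Fin N),
      Ω ((wordMap (simil D q r) w x)⁻¹ * wordMap (simil D q r) w y) = Ω (x⁻¹ * y) := by
    intro w
    induction w with
    | nil => simp [wordMap]
    | cons i w ih =>
      rw [← ih, wordMap, Function.comp_apply, Function.comp_apply, simil, simil]
      generalize wordMap (simil D q r) w x = a
      generalize wordMap (simil D q r) w y = b
      rw [← hΩ.2.2 (a⁻¹ * b) (r i) (hr i)]
      congr 1
      -- Expanding δ(a · a⁻¹b) avoids a separate statement about dilations of inverses.
      have := D.dil_mul_elem _ (hr i) a (a⁻¹ * b)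
      rw [mul_inv_cancel_left] at this
      rw [this]
      group
  rw [homKernel, homKernel, hang, dist_wordMap_eq (dist_simil hleft D q hr),
    Real.mul_rpow (wordRatio_pos hr w).le dist_nonneg, div_eq_mul_inv, div_eq_mul_inv, mul_inv]
  ring

theorem continuousOn_homKernel {G : Type*} [Group G] [MetricSpace G] [IsTopologicalGroup G]
    {D : GroupDilations G} {Ω : G → ℝ} (hΩ : IsZeroHomogeneous D Ω) (s : ℝ) :
    ContinuousOn (fun p : G × G => homKernel Ω s p.1 p.2) {p | p.1 ≠ p.2} := by
  unfold homKernel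
  refine ContinuousOn.div ?_ ?_ ?_
  · refine hΩ.1.comp (f := fun p : G × G => p.1⁻¹ * p.2) (by fun_prop) fun p hp => ?_
    simpa [inv_mul_eq_one] using hp
  · exact (continuous_dist.continuousOn).rpow_const fun p hp => Or.inl (dist_ne_zero.2 hp)
  · intro p hp
    exact (Real.rpow_pos_of_pos (dist_pos.2 hp) s).ne'

/-! ### Scaling of the Hausdorff measure -/

theorem hausdorffMeasure_image_of_dist {X : Type*} [MetricSpace X] [MeasurableSpace X]
    [BorelSpace X] {f : X → X} {c : ℝ} (hc : 0 < c) (hf : ∀ x y, dist (f x) (f y) = c * dist x y)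
    {s : ℝ} (hs : 0 ≤ s) (A : Set X) :
    Measure.hausdorffMeasure s (f '' A) = ENNReal.ofReal (c ^ s) * Measure.hausdorffMeasure s A := by
  lift c to NNReal using hc.le
  have hc' : 0 < c := by exact_mod_cast hc
  have h1 : LipschitzWith c f := LipschitzWith.of_dist_le_mul fun x y => (hf x y).le
  have h2 : AntilipschitzWith c⁻¹ f := AntilipschitzWith.of_le_mul_dist fun x y => by
    rw [hf, NNReal.coe_inv, inv_mul_cancel_left₀ hc.ne']
  have hcs : ENNReal.ofReal ((c : ℝ) ^ s) = (c : ℝ≥0∞) ^ s := by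
    rw [← ENNReal.ofReal_rpow_of_pos hc, ENNReal.ofReal_coe_nnreal]
  rw [hcs]
  refine le_antisymm (h1.hausdorffMeasure_image_le hs A) ?_
  have h3 := h2.le_hausdorffMeasure_image hs A
  rw [ENNReal.coe_inv hc'.ne', ENNReal.inv_rpow] at h3
  have h0 : (c : ℝ≥0∞) ^ s ≠ 0 := by simp [hc'.ne']
  have ht : (c : ℝ≥0∞) ^ s ≠ ⊤ := ENNReal.rpow_ne_top_of_nonneg hs ENNReal.coe_ne_top
  calc _ ≤ (c : ℝ≥0∞) ^ s * (((c : ℝ≥0∞) ^ s)⁻¹ * Measure.hausdorffMeasure s (f '' A)) := by gcongr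
    _ = _ := by rw [← mul_assoc, ENNReal.mul_inv_cancel h0 ht, one_mul]

theorem setIntegral_limitMeasure {X : Type*} [MetricSpace X] [MeasurableSpace X] [BorelSpace X]
    (s : ℝ) {C A : Set X} (hAC : A ⊆ C) (hA : MeasurableSet A) (g : X → ℝ) :
    ∫ y in A, g y ∂(limitMeasure s C) =
      ((Measure.hausdorffMeasure s C)⁻¹).toReal * ∫ y in A, g y ∂(Measure.hausdorffMeasure s) := by
  rw [limitMeasure, Measure.restrict_smul, Measure.restrict_restrict hA,
    inter_eq_self_of_subset_left hAC, integral_smul_measure, smul_eq_mul]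

/-- The restricted measure itself does not scale under `f`, but the Hausdorff measure does. The
passage to it is legitimate because both `A` and its image lie in `C`, and it costs the same
normalizing factor on each side. -/
theorem setIntegral_limitMeasure_image {X : Type*} [MetricSpace X] [CompleteSpace X]
    [MeasurableSpace X] [BorelSpace X] {f : X → X} {c : ℝ} (hc : 0 < c)
    (hf : ∀ x y, dist (f x) (f y) = c * dist x y) (hsurj : Function.Surjective f)
    {s : ℝ} (hs : 0 ≤ s) {C A : Set X} (hA : MeasurableSet A) (hAC : A ⊆ C) (hfA : f '' A ⊆ C)
    (g : X → ℝ) :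
    ∫ y in f '' A, g y ∂(limitMeasure s C) =
      c ^ s * ∫ y in A, g (f y) ∂(limitMeasure s C) := by
  have hemb : MeasurableEmbedding f := by
    have h1 : LipschitzWith c.toNNReal f := LipschitzWith.of_dist_le_mul fun x y => by
      rw [hf, Real.coe_toNNReal _ hc.le]
    have h2 : AntilipschitzWith c.toNNReal⁻¹ f :=
      AntilipschitzWith.of_le_mul_dist fun x y => by
        rw [hf, NNReal.coe_inv, Real.coe_toNNReal _ hc.le, inv_mul_cancel_left₀ hc.ne']
    exact (h2.isClosedEmbedding h1.uniformContinuous).measurableEmbedding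
  have hH : (Measure.hausdorffMeasure s : Measure X) =
      ENNReal.ofReal (c ^ s) • Measure.map f (Measure.hausdorffMeasure s) := by
    ext B hB
    rw [Measure.smul_apply, Measure.map_apply hemb.measurable hB, smul_eq_mul,
      ← hausdorffMeasure_image_of_dist hc hf hs, image_preimage_eq B hsurj]
  have hint : ∫ y in f '' A, g y ∂(Measure.hausdorffMeasure s) =
      c ^ s * ∫ y in A, g (f y) ∂(Measure.hausdorffMeasure s) := by
    conv_lhs => rw [hH]
    rw [Measure.restrict_smul, integral_smul_measure, hemb.setIntegral_map,
      preimage_image_eq A hemb.injective, ENNReal.toReal_ofReal (Real.rpow_nonneg hc.le s),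
      smul_eq_mul]
  rw [setIntegral_limitMeasure s hAC hA,
    setIntegral_limitMeasure s hfA (hemb.measurableSet_image.2 hA), hint]
  ring

/-- No estimate of H^s(C) is needed: the degenerate values 0 and ∞ both make the measure zero. -/
theorem isFiniteMeasure_limitMeasure {X : Type*} [MetricSpace X] [MeasurableSpace X]
    [BorelSpace X] (s : ℝ) (C : Set X) : IsFiniteMeasure (limitMeasure s C) := by
  rcases eq_or_ne (Measure.hausdorffMeasure s C) 0 with h | h
  · have : (Measure.hausdorffMeasure s).restrict C = 0 := Measure.restrict_eq_zero.2 h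
    rw [limitMeasure, this, smul_zero]
    infer_instance
  · refine ⟨?_⟩
    rw [limitMeasure, Measure.smul_apply, Measure.restrict_apply_univ, smul_eq_mul]
    rcases eq_or_ne (Measure.hausdorffMeasure s C) ⊤ with h' | h'
    · simp [h']
    · rw [ENNReal.inv_mul_cancel h h']; exact ENNReal.one_lt_top

/-! ### Continuity of truncated integrals -/

/-- The product of a small closed ball in `C` with the closure of `A` is compact and avoids the
diagonal. Having the bound uniform in `z` supplies the dominating constant for
`continuousWithinAt_integral_homKernel`. -/
theorem exists_bound_homKernel {G : Type*} [Group G] [MetricSpace G] [IsTopologicalGroup G]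
    {D : GroupDilations G} {Ω : G → ℝ} (hΩ : IsZeroHomogeneous D Ω) (s : ℝ) {C A : Set G}
    (hC : IsCompact C) (hAC : A ⊆ C) {x : G} (hxA : x ∉ closure A) :
    ∃ ε > 0, Disjoint (Metric.closedBall x ε) (closure A) ∧
      ∃ B, ∀ z ∈ C ∩ Metric.closedBall x ε, ∀ y ∈ A, ‖homKernel Ω s z y‖ ≤ B := by
  obtain ⟨ε, hε, hsub⟩ := Metric.nhds_basis_closedBall.mem_iff.1
    (isClosed_closure.isOpen_compl.mem_nhds hxA)
  have hdisj := disjoint_left.2 hsub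
  have hK : IsCompact ((C ∩ Metric.closedBall x ε) ×ˢ closure A) :=
    (hC.inter_right Metric.isClosed_closedBall).prod
      (hC.of_isClosed_subset isClosed_closure (closure_minimal hAC hC.isClosed))
  obtain ⟨B, hB⟩ := hK.exists_bound_of_continuousOn
    ((continuousOn_homKernel hΩ s).mono fun p hp h =>
      disjoint_left.1 hdisj hp.1.2 (h ▸ hp.2))
  exact ⟨ε, hε, hdisj, B, fun z hz y hy => hB (z, y) ⟨hz, subset_closure hy⟩⟩

theorem aestronglyMeasurable_homKernel {G : Type*} [Group G] [MetricSpace G]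
    [IsTopologicalGroup G] [MeasurableSpace G] [BorelSpace G]
    {D : GroupDilations G} {Ω : G → ℝ} (hΩ : IsZeroHomogeneous D Ω) (s : ℝ) {C A : Set G}
    (hC : IsCompact C) (hAC : A ⊆ C) {x : G} (hxA : x ∉ closure A)
    (μ : Measure G) : AEStronglyMeasurable (homKernel Ω s x) (μ.restrict A) := by
  have hcl : IsCompact (closure A) :=
    hC.of_isClosed_subset isClosed_closure (closure_minimal hAC hC.isClosed)
  have hcont : ContinuousOn (homKernel Ω s x) (closure A) :=
    (continuousOn_homKernel hΩ s).comp (f := fun y => (x, y)) (by fun_prop)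
      fun y hy (h : x = y) => hxA (h ▸ hy)
  exact (hcont.aestronglyMeasurable_of_isCompact hcl hcl.measurableSet).mono_measure
    (Measure.restrict_mono subset_closure le_rfl)

theorem integrableOn_homKernel {G : Type*} [Group G] [MetricSpace G] [IsTopologicalGroup G]
    [MeasurableSpace G] [BorelSpace G]
    {D : GroupDilations G} {Ω : G → ℝ} (hΩ : IsZeroHomogeneous D Ω) (s : ℝ) {C A : Set G}
    (hC : IsCompact C) (hAC : A ⊆ C) (hA : MeasurableSet A) {x : G} (hxC : x ∈ C)
    (hxA : x ∉ closure A) (μ : Measure G) [IsFiniteMeasure μ] :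
    IntegrableOn (homKernel Ω s x) A μ := by
  obtain ⟨ε, hε, -, B, hB⟩ := exists_bound_homKernel hΩ s hC hAC hxA
  refine IntegrableOn.of_bound (measure_lt_top μ A)
    (aestronglyMeasurable_homKernel hΩ s hC hAC hxA μ) B ?_
  exact (ae_restrict_mem hA).mono fun y hy => hB x ⟨hxC, Metric.mem_closedBall_self hε.le⟩ y hy

theorem continuousWithinAt_integral_homKernel {G : Type*} [Group G] [MetricSpace G]
    [IsTopologicalGroup G] [MeasurableSpace G] [BorelSpace G]
    {D : GroupDilations G} {Ω : G → ℝ} (hΩ : IsZeroHomogeneous D Ω) (s : ℝ) {C A : Set G}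
    (hC : IsCompact C) (hAC : A ⊆ C) (hA : MeasurableSet A) {x : G}
    (hxA : x ∉ closure A) (μ : Measure G) [IsFiniteMeasure μ] :
    ContinuousWithinAt (fun z => ∫ y in A, homKernel Ω s z y ∂μ) C x := by
  obtain ⟨ε, hε, hdisj, B, hB⟩ := exists_bound_homKernel hΩ s hC hAC hxA
  have hev : ∀ᶠ z in nhdsWithin x C, z ∈ C ∩ Metric.closedBall x ε :=
    inter_mem_nhdsWithin C (Metric.closedBall_mem_nhds x hε)
  refine continuousWithinAt_of_dominated (bound := fun _ => B) ?_ ?_ (integrable_const B) ?_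
  · filter_upwards [hev] with z hz
    exact aestronglyMeasurable_homKernel hΩ s hC hAC (disjoint_left.1 hdisj hz.2) μ
  · filter_upwards [hev] with z hz
    exact (ae_restrict_mem hA).mono fun y hy => hB z hz y hy
  · refine (ae_restrict_mem hA).mono fun y hy => ?_
    have hne : x ≠ y := fun h => hxA (h ▸ subset_closure hy)
    have h1 : ContinuousAt (fun p : G × G => homKernel Ω s p.1 p.2) (x, y) :=
      (continuousOn_homKernel hΩ s).continuousAt
        ((isOpen_ne_fun continuous_fst continuous_snd).mem_nhds hne)
    exact (ContinuousAt.comp (f := fun z => (z, y)) h1 (by fun_prop)).continuousWithinAt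

/-! ### Words in random sequences -/

/-- Almost every sequence contains a given word, beginning at a position `m ≥ 1`. -/
theorem ae_exists_initialWord_append {N : ℕ} {r : Fin N → ℝ} {s : ℝ} (hr : ∀ i, 0 < r i)
    (hs : ∑ i, r i ^ s = 1) (u : List (Fin N)) :
    ∀ᵐ v ∂(codeMeasure r s), ∃ m, 1 ≤ m ∧ initialWord v (m + u.length) = initialWord v m ++ u := by
  have hprob : IsProbabilityMeasure
      (∑ i, ENNReal.ofReal (r i ^ s) • (Measure.dirac i : Measure (Fin N))) := by
    refine ⟨?_⟩
    simp only [Measure.coe_finsetSum, Finset.sum_apply, Measure.smul_apply, measure_univ,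
      smul_eq_mul, mul_one]
    rw [← ENNReal.ofReal_sum_of_nonneg fun i _ => (Real.rpow_pos_of_pos (hr i) s).le, hs,
      ENNReal.ofReal_one]
  have := isProbabilityMeasure_codeMeasure hr hs
  set ν := (∑ i, ENNReal.ofReal (r i ^ s) • (Measure.dirac i : Measure (Fin N))) with hν
  set l := u.length with hl
  rcases Nat.eq_zero_or_pos l with hl0 | hl0
  · refine Filter.Eventually.of_forall fun v => ⟨1, le_rfl, ?_⟩
    simp [hl0, List.length_eq_zero_iff.1 (hl ▸ hl0)]
  -- Disjoint consecutive blocks of length `l`; the offset 1 ensures a nonempty prefix.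
  let pos : ℕ × Fin l → ℕ := fun p => 1 + p.1 * l + p.2
  have hpos : Function.Injective pos := by
    rintro ⟨a, i⟩ ⟨b, j⟩ h
    have h' : a * l + i = b * l + j := by simpa [pos, add_assoc] using h
    have h1 : (a * l + i) / l = a := by
      rw [mul_comm, Nat.mul_add_div hl0, Nat.div_eq_of_lt i.2, add_zero]
    have h2 : (b * l + j) / l = b := by
      rw [mul_comm, Nat.mul_add_div hl0, Nat.div_eq_of_lt j.2, add_zero]
    have hab : a = b := by rw [← h1, ← h2, h']
    subst hab
    exact Prod.ext rfl (Fin.ext (by simpa using h'))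
  let E : ℕ → Set (ℕ → Fin N) := fun k => {v | ∀ i : Fin l, v (pos (k, i)) = u.get i}
  -- The letter prescribed at each position turns intersections of the events `E k` into boxes,
  -- whose product measure is explicit. The value at 0 is a dummy, as no block contains position 0.
  let tgt : ℕ → Fin N := fun n => if h : n = 0 then u.get ⟨0, hl0⟩ else
    u.get ⟨(n - 1) % l, Nat.mod_lt _ hl0⟩
  have htgt : ∀ k (i : Fin l), tgt (pos (k, i)) = u.get i := by
    intro k i
    have h1 : pos (k, i) - 1 = l * k + i := by simp only [pos]; rw [mul_comm]; omega
    have h0 : pos (k, i) ≠ 0 := by simp only [pos]; omega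
    simp only [tgt, dif_neg h0, h1]
    congr 1
    exact Fin.ext (by simp [Nat.mod_eq_of_lt i.2])
  have hEm : ∀ k, MeasurableSet (E k) := fun k => by
    simp only [E, ofPred_forall]
    exact MeasurableSet.iInter fun i => measurableSet_eq_fun (measurable_pi_apply (pos (k, i))) measurable_const
  have hinter : ∀ t : Finset ℕ, codeMeasure r s (⋂ k ∈ t, E k) =
      ∏ k ∈ t, ∏ i : Fin l, ν {u.get i} := by
    intro t
    have : (⋂ k ∈ t, E k) = Set.pi ((t ×ˢ Finset.univ).map ⟨pos, hpos⟩ : Finset ℕ)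
        (fun n => {tgt n}) := by
      ext v
      simp only [E, mem_iInter, mem_ofPred_eq, Set.mem_pi, Finset.coe_map, mem_image,
        Finset.mem_coe, Finset.mem_product, Finset.mem_univ, and_true, Function.Embedding.coeFn_mk,
        mem_singleton_iff]
      constructor
      · rintro h _ ⟨⟨k, i⟩, hk, rfl⟩
        rw [h k hk i, htgt]
      · intro h k hk i
        rw [h _ ⟨(k, i), hk, rfl⟩, htgt]
    rw [this, codeMeasure, Measure.infinitePi_pi _ fun _ _ => measurableSet_singleton _,
      Finset.prod_map, Finset.prod_product]
    simp only [Function.Embedding.coeFn_mk, htgt, ← hν]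
  have hE : ∀ k, codeMeasure r s (E k) = ∏ i : Fin l, ν {u.get i} := fun k => by
    simpa using hinter {k}
  have hind : ProbabilityTheory.iIndepSet E (codeMeasure r s) :=
    (ProbabilityTheory.iIndepSet_iff_meas_biInter hEm).2 fun t => by
      rw [hinter]; simp only [hE]
  have hne : (∏ i : Fin l, ν {u.get i}) ≠ 0 := by
    refine Finset.prod_ne_zero_iff.2 fun i _ => ?_
    rw [hν, Measure.coe_finsetSum, Finset.sum_apply]
    refine (lt_of_lt_of_le ?_ (Finset.single_le_sum (fun _ _ => zero_le)
      (Finset.mem_univ (u.get i)))).ne'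
    simpa using Real.rpow_pos_of_pos (hr _) s
  -- Second Borel–Cantelli lemma: the block events are independent with the same positive
  -- probability.
  have hlim := ProbabilityTheory.measure_limsup_eq_one hEm hind
    (by simp only [hE]; exact ENNReal.tsum_const_eq_top_of_ne_zero hne)
  have hae : ∀ᵐ v ∂(codeMeasure r s), v ∈ Filter.limsup E Filter.atTop :=
    (prob_compl_eq_zero_iff (MeasurableSet.measurableSet_limsup hEm)).2 hlim
  filter_upwards [hae] with v hv
  rw [Filter.mem_limsup_iff_frequently_mem] at hv
  obtain ⟨k, hk⟩ := hv.exists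
  refine ⟨1 + k * l, by omega, ?_⟩
  rw [initialWord, initialWord, List.ofFn_add]
  congr 1
  · apply List.ext_get
    · simp [hl]
    · intro n h1 h2
      simpa [pos] using hk ⟨n, h2⟩

/-! ### Truncated integrals over differences of pieces -/

theorem initialWord_add {N : ℕ} (v : ℕ → Fin N) (m n : ℕ) :
    initialWord v (m + n) = initialWord v m ++ List.ofFn fun i : Fin n => v (m + i) := by
  rw [initialWord, initialWord, List.ofFn_add]
  rfl

theorem length_wordPow {N : ℕ} (w : List (Fin N)) (n : ℕ) :
    (wordPow w n).length = n * w.length := by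
  simp [wordPow]

/-- A negative exponent would make every summand at least 1 and the sum at least 2. -/
theorem dimension_nonneg {N : ℕ} (hN : 2 ≤ N) {r : Fin N → ℝ} (hr : ∀ i, 0 < r i ∧ r i < 1)
    {s : ℝ} (hs : ∑ i, r i ^ s = 1) : 0 ≤ s := by
  by_contra! hneg
  have h1 : ∀ i, 1 ≤ r i ^ s := fun i =>
    Real.one_le_rpow_of_pos_of_le_one_of_nonpos (hr i).1 (hr i).2.le hneg.le
  have h2 : (N : ℝ) ≤ ∑ i, r i ^ s := by
    simpa using Finset.sum_le_sum fun i (_ : i ∈ Finset.univ) => h1 i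
  have h3 : (2 : ℝ) ≤ N := by exact_mod_cast hN
  linarith

theorem measurableSet_piece {X : Type*} [MetricSpace X] [MeasurableSpace X] [BorelSpace X] {N : ℕ}
    {S : Fin N → X → X} {r : Fin N → ℝ} (hr : ∀ i, 0 < r i)
    (hS : ∀ i x y, dist (S i x) (S i y) = r i * dist x y) {C : Set X} (hC : IsLimitSet S C)
    (w : List (Fin N)) : MeasurableSet (piece S C w) :=
  (hC.2.1.image (continuous_wordMap hr hS w)).measurableSet

/-- The exponent of the kernel equals that of the measure, so the two scaling factors cancel.
Integrability is not needed. -/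
theorem setIntegral_homKernel_piece_diff {G : Type*} [Group G] [MetricSpace G]
    [CompleteSpace G] [MeasurableSpace G] [BorelSpace G]
    (hleft : ∀ g : G, Isometry fun x : G => g * x)
    (D : GroupDilations G) {N : ℕ} (q : Fin N → G) {r : Fin N → ℝ} (hr : ∀ i, 0 < r i)
    {s : ℝ} (hs : 0 ≤ s) {C : Set G} (hC : IsLimitSet (simil D q r) C)
    {Ω : G → ℝ} (hΩ : IsZeroHomogeneous D Ω) (p u : List (Fin N)) (z : G) :
    ∫ y in piece (simil D q r) C p \ piece (simil D q r) C (p ++ u),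
        homKernel Ω s (wordMap (simil D q r) p z) y ∂(limitMeasure s C) =
      ∫ y in C \ piece (simil D q r) C u, homKernel Ω s z y ∂(limitMeasure s C) := by
  have hS := dist_simil hleft D q hr
  have hset : piece (simil D q r) C p \ piece (simil D q r) C (p ++ u) =
      wordMap (simil D q r) p '' (C \ piece (simil D q r) C u) := by
    rw [piece_append, image_sdiff (wordMap_injective hr hS p), piece]
  rw [hset, setIntegral_limitMeasure_image (wordRatio_pos hr p) (dist_wordMap_eq hS p)
    (wordMap_surjective (simil_surjective D q hr) p) hs
    (hC.2.1.measurableSet.diff (measurableSet_piece hr hS hC u)) sdiff_subset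
    ((image_mono sdiff_subset).trans (hC.piece_subset p))]
  simp only [homKernel_wordMap hleft D q hr hΩ]
  rw [integral_const_mul, mul_inv_cancel_left₀ (Real.rpow_pos_of_pos (wordRatio_pos hr p) s).ne']

/-- Split off C ∖ C_w; what remains is the image under S_w of the previous truncation, seen from the
same point `x`, so each step adds the same amount. -/
theorem setIntegral_homKernel_diff_wordPow {G : Type*} [Group G] [MetricSpace G]
    [IsTopologicalGroup G] [CompleteSpace G] [MeasurableSpace G] [BorelSpace G]
    (hleft : ∀ g : G, Isometry fun x : G => g * x)
    (D : GroupDilations G) (hdoubling : IsDoublingSpace G)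
    {N : ℕ} (q : Fin N → G) {r : Fin N → ℝ} (hr : ∀ i, 0 < r i ∧ r i < 1)
    (hosc : OpenSetCondition (simil D q r)) {s : ℝ} (hs : 0 ≤ s)
    {C : Set G} (hC : IsLimitSet (simil D q r) C)
    {Ω : G → ℝ} (hΩ : IsZeroHomogeneous D Ω)
    {w : List (Fin N)} {x : G} (hxC : x ∈ C) (hx : wordMap (simil D q r) w x = x) (n : ℕ) :
    ∫ y in C \ piece (simil D q r) C (wordPow w n), homKernel Ω s x y ∂(limitMeasure s C) =
      n * ∫ y in C \ piece (simil D q r) C w, homKernel Ω s x y ∂(limitMeasure s C) := by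
  have hr0 : ∀ i, 0 < r i := fun i => (hr i).1
  have hS := dist_simil hleft D q hr0
  have hfin := isFiniteMeasure_limitMeasure s C
  have hmeas := measurableSet_piece hr0 hS hC
  induction n with
  | zero => simp [wordPow, piece, wordMap]
  | succ n ih =>
    have hdec : C \ piece (simil D q r) C (wordPow w (n + 1)) =
        (C \ piece (simil D q r) C w) ∪
          (piece (simil D q r) C w \ piece (simil D q r) C (w ++ wordPow w n)) := by
      have h1 := hC.piece_subset w
      have h2 := hC.piece_append_subset w (wordPow w n)
      rw [wordPow_succ, sdiff_union_sdiff_cancel h1 h2]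
    have hint : IntegrableOn (homKernel Ω s x) (C \ piece (simil D q r) C (wordPow w (n + 1)))
        (limitMeasure s C) :=
      integrableOn_homKernel hΩ s hC.2.1 sdiff_subset (hC.2.1.measurableSet.diff (hmeas _)) hxC
        (notMem_closure_diff_piece hr hS (simil_surjective D q hr0) hdoubling hosc hC
          (wordMap_wordPow_fixed hx (n + 1))) _
    rw [hdec] at hint ⊢
    have htail := setIntegral_homKernel_piece_diff hleft D q hr0 hs hC hΩ w (wordPow w n) x
    rw [hx, ih] at htail
    rw [setIntegral_union (disjoint_sdiff_left.mono_right sdiff_subset)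
      ((hmeas _).diff (hmeas _)) hint.left_of_union hint.right_of_union, htail]
    push_cast
    ring

/-- For an integrable function both parts are finite, so no information is lost on passing to real
values. -/
theorem HasNonzeroIntegralOn.integral_ne_zero {X : Type*} [MeasurableSpace X] {μ : Measure X}
    {A : Set X} {g : X → ℝ} (h : HasNonzeroIntegralOn μ A g) (hg : IntegrableOn g A μ) :
    ∫ y in A, g y ∂μ ≠ 0 := by
  rw [integral_eq_lintegral_pos_part_sub_lintegral_neg_part hg, sub_ne_zero]
  intro heq
  refine h ((ENNReal.toReal_eq_toReal_iff' ?_ ?_).1 heq)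
  · exact hg.lintegral_lt_top.ne
  · exact hg.neg.lintegral_lt_top.ne

end MetricGroupIFS

theorem mainTheorem5 {G : Type*} [Group G] [MetricSpace G] [IsTopologicalGroup G]
    [CompleteSpace G] [MeasurableSpace G] [BorelSpace G]
    (hleft : ∀ g : G, Isometry fun x : G => g * x)
    (D : GroupDilations G) (hdoubling : IsDoublingSpace G)
    {N : ℕ} (hN : 2 ≤ N) (q : Fin N → G) (r : Fin N → ℝ) (hr : ∀ i, 0 < r i ∧ r i < 1)
    (hosc : OpenSetCondition (simil D q r))
    (s : ℝ) (hs : ∑ i, r i ^ s = 1)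
    (C : Set G) (hC : IsLimitSet (simil D q r) C)
    (Ω : G → ℝ) (hΩ : IsZeroHomogeneous D Ω)
    (w : List (Fin N)) (x : G) (hxC : x ∈ C) (hx : wordMap (simil D q r) w x = x)
    (hint : HasNonzeroIntegralOn (limitMeasure s C) (C \ piece (simil D q r) C w)
      (homKernel Ω s x)) :
    ∀ᵐ v ∂(codeMeasure r s),
      symbolicMaximal (simil D q r) C (limitMeasure s C) (homKernel Ω s) (fun _ => 1) v = ⊤ := by
  have hr0 : ∀ i, 0 < r i := fun i => (hr i).1
  have hS := dist_simil hleft D q hr0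
  have hsurj := simil_surjective D q hr0
  have hs0 := dimension_nonneg hN hr hs
  have hfin := isFiniteMeasure_limitMeasure s C
  have hmeas : ∀ u, MeasurableSet (C \ piece (simil D q r) C u) := fun u =>
    hC.2.1.measurableSet.diff (measurableSet_piece hr0 hS hC u)
  -- For the empty word the domain C ∖ C_w is empty.
  have hw : w ≠ [] := by
    rintro rfl
    exact hint (by simp [piece, wordMap])
  have hη := hint.integral_ne_zero (integrableOn_homKernel hΩ s hC.2.1 sdiff_subset (hmeas w) hxC
    (notMem_closure_diff_piece hr hS hsurj hdoubling hosc hC hx) _)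
  have hMη := setIntegral_homKernel_diff_wordPow hleft D hdoubling q hr hosc hs0 hC hΩ hxC hx
  set η := ∫ y in C \ piece (simil D q r) C w, homKernel Ω s x y ∂(limitMeasure s C)
  have hα0 := wordRatio_pos hr0 w
  have hα1 := wordRatio_lt_one hr hw
  filter_upwards [ae_all_iff.2 fun n => ae_exists_initialWord_append hr0 hs (wordPow w n)] with v hv
  have key : ∀ M : ℕ, 1 ≤ M → ENNReal.ofReal (M * |η| - 1) ≤
      symbolicMaximal (simil D q r) C (limitMeasure s C) (homKernel Ω s) (fun _ => 1) v := by
    intro M hM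
    have hcont := continuousWithinAt_integral_homKernel hΩ s hC.2.1 sdiff_subset
      (hmeas (wordPow w M)) (notMem_closure_diff_piece hr hS hsurj hdoubling hosc hC
        (wordMap_wordPow_fixed hx M)) (limitMeasure s C)
    obtain ⟨δ, hδ0, hδ⟩ := Metric.continuousWithinAt_iff.1 hcont 1 one_pos
    have hlim : Filter.Tendsto (fun n : ℕ => wordRatio r w ^ n * Metric.diam C) Filter.atTop
        (nhds 0) := by
      simpa using (tendsto_pow_atTop_nhds_zero_of_lt_one hα0.le hα1).mul_const (Metric.diam C)
    -- Two lengths play different roles: the first `M` copies of `w` determine the truncation, while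
    -- all `K` copies force the rescaled base point `z` to within `δ` of `x`.
    obtain ⟨K, hK, hMK⟩ := ((hlim.eventually_lt_const hδ0).and
      (Filter.eventually_ge_atTop M)).exists
    obtain ⟨m, hm1, hm⟩ := hv K
    have hlen : m < m + (wordPow w M).length := by
      rw [length_wordPow]
      have := Nat.mul_pos hM (List.length_pos_of_ne_nil hw)
      omega
    have hword : initialWord v (m + (wordPow w M).length) = initialWord v m ++ wordPow w M := by
      obtain ⟨j, rfl⟩ := Nat.exists_eq_add_of_le hMK
      rw [wordPow_add, List.length_append, ← add_assoc, initialWord_add v (m + _),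
        ← List.append_assoc] at hm
      exact (List.append_inj hm (by simp [initialWord])).1
    have hmem : codingMap (simil D q r) C v ∈
        piece (simil D q r) C (initialWord v (m + (wordPow w K).length)) := by
      have := (singleton_codingMap hr hS hC v).subset rfl
      exact mem_iInter.1 this _
    rw [hm, piece_append] at hmem
    obtain ⟨_, ⟨c, hc, rfl⟩, hz⟩ := hmem
    set z := wordMap (simil D q r) (wordPow w K) c with hz_def
    have hzC : z ∈ C := hC.piece_subset (wordPow w K) ⟨c, hc, rfl⟩
    have hzx : dist z x < δ := by
      conv_lhs => rw [← wordMap_wordPow_fixed hx K]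
      rw [hz_def, dist_wordMap_eq hS, wordRatio_wordPow]
      refine lt_of_le_of_lt ?_ hK
      gcongr
      exact Metric.dist_le_diam_of_mem hC.2.1.isBounded hc hxC
    have hclose := hδ hzC hzx
    rw [hMη, Real.dist_eq] at hclose
    -- Transport the estimate at `z` back to π(v) by the similarity of the prefix.
    have hval := setIntegral_homKernel_piece_diff hleft D q hr0 hs0 hC hΩ (initialWord v m)
      (wordPow w M) z
    rw [hz, ← hword] at hval
    rw [← hval] at hclose
    unfold symbolicMaximal
    refine le_trans ?_ (le_iSup₂_of_le m (m + (wordPow w M).length)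
      (le_iSup₂_of_le hm1 hlen le_rfl))
    simp only [mul_one]
    refine ENNReal.ofReal_le_ofReal ?_
    have h1 := abs_sub_abs_le_abs_sub ((M : ℝ) * η) (∫ y in
      piece (simil D q r) C (initialWord v m) \
        piece (simil D q r) C (initialWord v (m + (wordPow w M).length)),
      homKernel Ω s (codingMap (simil D q r) C v) y ∂(limitMeasure s C))
    rw [abs_sub_comm, abs_mul, Nat.abs_cast] at h1
    linarith
  refine ENNReal.eq_top_of_forall_nnreal_le fun b => ?_
  obtain ⟨M, hM⟩ := exists_nat_gt (((b : ℝ) + 1) / |η|)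
  rw [div_lt_iff₀ (abs_pos.2 hη)] at hM
  have hM1 : 1 ≤ M := by
    rcases Nat.eq_zero_or_pos M with rfl | h
    · simp at hM
      linarith [b.coe_nonneg]
    · exact h
  refine le_trans ?_ (key M hM1)
  rw [← ENNReal.ofReal_coe_nnreal]
  exact ENNReal.ofReal_le_ofReal (by linarith)
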